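/- **Corollary 4.2.** Let $p>1$ and $q>1$ with $p^{-1}+q^{-1}=1$, and let $X_1,\dots,X_n$ be independent nonnegative random variables such that $$X_1\ge_{\mathrm{lr}}X_2\ge_{\mathrm{lr}}\cdots\ge_{\mathrm{lr}}X_n .$$ Suppose that, for each $i$, $X_i^p$ has a density $f$ (with respect to Lebesgue measure on $\mathbb R$) that is log-concave, i.e. $f(\alpha x+(1-\alpha)y)\ge f(x)^{\alpha}f(y)^{1-\alpha}$ for all $x,y\in\mathbb R$ and $\alpha\in[0,1]$. Then for all $\mathbf a=(a_1,\dots,a_n)$ and $\mathbf b=(b_1,\dots,b_n)$ in $[0,\infty)^n$, $$(a_1^q,\dots,a_n^q)\preceq^{\mathrm w}(b_1^q,\dots,b_n^q)\quad\Longrightarrow\quad \sum_{i=1}^n a_{(i)}X_i\ \ge_{\mathrm{st}}\ \sum_{i=1}^n b_{(i)}X_i .$$ Here $x_{(1)}\le\cdots\le x_{(n)}$ denotes the increasing arrangement of the components of $\mathbf x\in\mathbb R^n$. For $\mathbf x,\mathbf y\in\mathbb R^n$, $\mathbf x\preceq^{\mathrm w}\mathbf y$ ($\mathbf x$ is weakly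 supmajorized by $\mathbf y$) means $\sum_{i=1}^j x_{(i)}\ge\sum_{i=1}^j y_{(i)}$ for $j=1,\dots,n$. For real random variables $X,Y$, $Y\ge_{\mathrm{st}}X$ means $P(Y\le t)\le P(X\le t)$ for all $t\in\mathbb R$. Finally, $Y\ge_{\mathrm{lr}}X$ means that $X$ and $Y$ have densities $f$ and $g$, respectively, such that $g(x)/f(x)$ is increasing (in the weak sense) in $x$ on the set where $f$ and $g$ do not both vanish, with the convention $c/0=\infty$ for $c>0$. -/

import Mathlib

open MeasureTheory ProbabilityTheory

noncomputable section

/-- `f` is a (version of the) probability density function, with respect to Lebesgue measure,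
of the real random variable `X`. -/
def IsDensityOf {Ω : Type*} [MeasurableSpace Ω] (μ : Measure Ω) (X : Ω → ℝ) (f : ℝ → ℝ) : Prop :=
  Measurable f ∧ (∀ x, 0 ≤ f x) ∧
    μ.map X = volume.withDensity (fun x => ENNReal.ofReal (f x))

/-- A nonnegative function `h` is log-concave on a set `A` if `A` is convex and
`h (α x + (1 - α) y) ≥ h x ^ α * h y ^ (1 - α)` for all `x, y ∈ A` and `α ∈ [0, 1]`. -/
def IsLogConcaveOn {E : Type*} [AddCommGroup E] [Module ℝ E] (A : Set E) (h : E → ℝ) : Prop :=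
  Convex ℝ A ∧ (∀ x ∈ A, 0 ≤ h x) ∧
    ∀ x ∈ A, ∀ y ∈ A, ∀ α : ℝ, 0 ≤ α → α ≤ 1 →
      h x ^ α * h y ^ (1 - α) ≤ h (α • x + (1 - α) • y)

/-- `X` has a log-concave density function. -/
def HasLogConcaveDensity {Ω : Type*} [MeasurableSpace Ω] (μ : Measure Ω) (X : Ω → ℝ) : Prop :=
  ∃ f : ℝ → ℝ, IsDensityOf μ X f ∧ IsLogConcaveOn Set.univ f

/-- The usual stochastic order `X ≤_st Y`: the distribution functions satisfy
`P(X ≤ t) ≥ P(Y ≤ t)` for all `t`. -/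
def StochasticLE {Ω : Type*} [MeasurableSpace Ω] (μ : Measure Ω) (X Y : Ω → ℝ) : Prop :=
  ∀ t : ℝ, μ {ω | Y ω ≤ t} ≤ μ {ω | X ω ≤ t}

/-- The likelihood ratio order `X ≤_lr Y`: for suitable versions `f`, `g` of the densities of
`X`, `Y`, the ratio `g / f` is increasing on the set where it is well defined, i.e. where `f` and
`g` do not both vanish. The ratio takes values in `[0, ∞]`, with `c / 0 = ∞` for `c > 0`. -/
def LikelihoodRatioLE {Ω : Type*} [MeasurableSpace Ω] (μ : Measure Ω) (X Y : Ω → ℝ) : Prop :=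
  ∃ f g : ℝ → ℝ, IsDensityOf μ X f ∧ IsDensityOf μ Y g ∧
    MonotoneOn (fun x => ENNReal.ofReal (g x) / ENNReal.ofReal (f x)) {x | f x ≠ 0 ∨ g x ≠ 0}

/-- The increasing arrangement `x_(1) ≤ x_(2) ≤ ⋯ ≤ x_(n)` of the components of `x`. -/
def increasingArrangement {n : ℕ} (x : Fin n → ℝ) : Fin n → ℝ :=
  x ∘ Tuple.sort x

/-- `x` is weakly supmajorized by `y`: `∑_{i ≤ j} x_(i) ≥ ∑_{i ≤ j} y_(i)` for all `j`. -/
def WeaklySupmajorizedBy {n : ℕ} (x y : Fin n → ℝ) : Prop :=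
  ∀ j : Fin n,
    ∑ i ∈ Finset.Iic j, increasingArrangement y i ≤ ∑ i ∈ Finset.Iic j, increasingArrangement x i

end

/-! Fix `t` and use the `q`-th powers `v` of the weights as coordinates: the claim compares values
of `v ↦ P(∑ v i ^ q⁻¹ * X i ≤ t)`. By `le_of_partial_sums_le` it suffices that this is antitone,
which is clear from `X i ≥ 0`, and that it does not grow when mass moves from a later, larger
coordinate to an earlier, smaller one. Conditioning on the other summands (`StochasticLE.add_right`)
leaves two variables.

For those, let `G (a, b) = P(s < a ^ q⁻¹ * X + b ^ q⁻¹ * Y)`. In terms of `X ^ p` and `Y ^ p`, each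
summand is jointly concave in weight and variable, by Hölder with exponents `p` and `q`; since the
densities are log-concave, Prékopa-Leindler makes `G` log-concave (`measure_lt_log_concave`). The
likelihood ratio order gives `G (a, b) ≤ G (b, a)` for `a ≤ b` (`measure_lt_swap_le`). A transfer
lands on the segment from `(a, b)` to `(b, a)`, where `G` is therefore at least `G (a, b)`. -/

/-! ### Brunn-Minkowski on the line and Prékopa-Leindler -/

open scoped ENNReal Pointwise in
/-- One-dimensional Brunn-Minkowski inequality for compact sets. -/
lemma volume_add_volume_le_of_isCompact {K L : Set ℝ} (hK : IsCompact K) (hL : IsCompact L)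
    (hK0 : K.Nonempty) (hL0 : L.Nonempty) :
    volume K + volume L ≤ volume (K + L) := by
  obtain ⟨a, haK, ha⟩ := hK.exists_isGreatest hK0
  obtain ⟨b, hbL, hb⟩ := hL.exists_isLeast hL0
  -- With `a = max K` and `b = min L`, the two translates meet at most in `a + b`.
  have hsub : ((fun x => x + b) '' K) ∪ ((fun x => a + x) '' L) ⊆ K + L := by
    rintro _ (⟨x, hx, rfl⟩ | ⟨x, hx, rfl⟩)
    · exact Set.add_mem_add hx hbL
    · exact Set.add_mem_add haK hx
  refine le_trans ?_ (measure_mono hsub)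
  rw [measure_union₀ (hL.image (by fun_prop)).measurableSet.nullMeasurableSet]
  · rw [Set.image_add_right, Set.image_add_left, measure_preimage_add_right,
      measure_preimage_add]
  · refine measure_mono_null (t := {a + b}) ?_ (by simp)
    rintro _ ⟨⟨x, hx, rfl⟩, ⟨y, hy, hxy⟩⟩
    have h1 := ha hx
    have h2 := hb hy
    simp only at hxy
    simp only [Set.mem_singleton_iff]
    linarith

open scoped ENNReal Pointwise in
/-- One-dimensional Brunn-Minkowski inequality for convex combinations of measurable sets. -/
lemma ofReal_mul_volume_add_le {l m : ℝ} (hl : 0 ≤ l) (hm : 0 ≤ m) {A B C : Set ℝ}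
    (hA : MeasurableSet A) (hB : MeasurableSet B) (hA0 : A.Nonempty) (hB0 : B.Nonempty)
    (hC : ∀ x ∈ A, ∀ y ∈ B, l * x + m * y ∈ C) :
    ENNReal.ofReal l * volume A + ENNReal.ofReal m * volume B ≤ volume C := by
  rw [hA.measure_eq_iSup_isCompact, hB.measure_eq_iSup_isCompact]
  simp_rw [ENNReal.mul_iSup]
  have key : ∀ K ⊆ A, IsCompact K → K.Nonempty → ∀ L ⊆ B, IsCompact L → L.Nonempty →
      ENNReal.ofReal l * volume K + ENNReal.ofReal m * volume L ≤ volume C := by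
    intro K hKA hK hK0 L hLB hL hL0
    have h := volume_add_volume_le_of_isCompact (hK.smul l) (hL.smul m) (hK0.smul_set)
      (hL0.smul_set)
    rw [Measure.addHaar_smul_of_nonneg _ hl, Measure.addHaar_smul_of_nonneg _ hm] at h
    simp only [Module.finrank_self, pow_one] at h
    refine h.trans (measure_mono ?_)
    rintro _ ⟨_, ⟨x, hx, rfl⟩, _, ⟨y, hy, rfl⟩, rfl⟩
    exact hC x (hKA hx) y (hLB hy)
  obtain ⟨x, hx⟩ := hA0
  obtain ⟨y, hy⟩ := hB0
  simp_rw [iSup_and']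
  refine ENNReal.biSup_add_biSup_le' ⟨∅, by simp⟩ ⟨∅, by simp⟩ ?_
  -- The sumset bound fails for an empty compact set, so each approximant is enlarged by a point.
  have aux : ∀ {D : Set ℝ} {z : ℝ}, z ∈ D → ∀ K, K ⊆ D ∧ IsCompact K →
      ∃ K' ⊆ D, IsCompact K' ∧ K'.Nonempty ∧ K ⊆ K' := by
    intro D z hz K hK
    exact ⟨insert z K, Set.insert_subset hz hK.1, hK.2.insert z, Set.insert_nonempty z K,
      Set.subset_insert z K⟩
  intro K hK L hL
  obtain ⟨K', h1, h2, h3, h4⟩ := aux hx K hK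
  obtain ⟨L', h5, h6, h7, h8⟩ := aux hy L hL
  refine le_trans ?_ (key K' h1 h2 h3 L' h5 h6 h7)
  gcongr

open scoped ENNReal in
lemma lintegral_eq_lintegral_volume_lt {f : ℝ → ℝ≥0∞} (hf : Measurable f) :
    ∫⁻ x, f x = ∫⁻ t in Set.Ioi (0 : ℝ), volume {x | ENNReal.ofReal t < f x} := by
  have hS : MeasurableSet {z : ℝ × ℝ | ENNReal.ofReal z.2 < f z.1} :=
    measurableSet_lt (by fun_prop) (by fun_prop)
  have h1 : ∀ x, f x = ∫⁻ t in Set.Ioi (0 : ℝ),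
      {z : ℝ × ℝ | ENNReal.ofReal z.2 < f z.1}.indicator 1 (x, t) := by
    intro x
    have : (fun t => {z : ℝ × ℝ | ENNReal.ofReal z.2 < f z.1}.indicator (1 : ℝ × ℝ → ℝ≥0∞) (x, t))
        = {t : ℝ | ENNReal.ofReal t < f x}.indicator 1 := by
      ext t; simp [Set.indicator]
    rw [this, lintegral_indicator_one (measurableSet_lt (by fun_prop) (by fun_prop)),
      Measure.restrict_apply (measurableSet_lt (by fun_prop) (by fun_prop))]
    by_cases htop : f x = ⊤
    · simp [htop]
    · have : {t : ℝ | ENNReal.ofReal t < f x} ∩ Set.Ioi 0 = Set.Ioo 0 (f x).toReal := by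
        ext t
        simp only [Set.mem_inter_iff, Set.mem_ofPred_eq, Set.mem_Ioi, Set.mem_Ioo]
        constructor
        · rintro ⟨h, ht⟩
          exact ⟨ht, (ENNReal.ofReal_lt_iff_lt_toReal ht.le htop).1 h⟩
        · rintro ⟨ht, h⟩
          exact ⟨(ENNReal.ofReal_lt_iff_lt_toReal ht.le htop).2 h, ht⟩
      rw [this]
      simp [htop]
  rw [lintegral_congr h1, lintegral_lintegral_swap]
  · refine lintegral_congr fun t => ?_
    rw [← lintegral_indicator_one (measurableSet_lt (by fun_prop) hf)]
    refine lintegral_congr fun x => ?_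
    simp [Set.indicator]
  · exact (measurable_one.indicator hS).aemeasurable

open scoped ENNReal in
lemma ENNReal.geom_mean_le_arith_mean2_weighted {l m : ℝ} (hl : 0 < l) (hm : 0 < m)
    (hlm : l + m = 1) (A B : ℝ≥0∞) :
    A ^ l * B ^ m ≤ ENNReal.ofReal l * A + ENNReal.ofReal m * B := by
  have hl' : ENNReal.ofReal l ≠ 0 := by simpa using hl
  have hm' : ENNReal.ofReal m ≠ 0 := by simpa using hm
  rcases eq_or_ne A ⊤ with rfl | hA
  · simp [ENNReal.mul_top hl']
  rcases eq_or_ne B ⊤ with rfl | hB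
  · simp [ENNReal.mul_top hm']
  have h := Real.geom_mean_le_arith_mean2_weighted hl.le hm.le (A.toReal_nonneg) (B.toReal_nonneg)
    hlm
  have h2 := ENNReal.ofReal_le_ofReal h
  rw [ENNReal.ofReal_mul (by positivity), ENNReal.ofReal_add (by positivity) (by positivity),
    ENNReal.ofReal_mul hl.le, ENNReal.ofReal_mul hm.le,
    ← ENNReal.ofReal_rpow_of_nonneg (by positivity) hl.le,
    ← ENNReal.ofReal_rpow_of_nonneg (by positivity) hm.le,
    ENNReal.ofReal_toReal hA, ENNReal.ofReal_toReal hB] at h2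
  exact h2

-- Compare superlevel sets at each height `t` by Brunn-Minkowski. Equal suprema are essential: the
-- level sets of `f` and `g` are nonempty for the same heights, `t < 1`.
open scoped ENNReal in
lemma lintegral_add_le_of_iSup_eq_one {l m : ℝ} (hl : 0 < l) (hm : 0 < m) (hlm : l + m = 1)
    {f g h : ℝ → ℝ≥0∞} (hf : Measurable f) (hg : Measurable g) (hh : Measurable h)
    (hf1 : ⨆ x, f x = 1) (hg1 : ⨆ x, g x = 1)
    (H : ∀ x y, f x ^ l * g y ^ m ≤ h (l * x + m * y)) :
    ENNReal.ofReal l * (∫⁻ x, f x) + ENNReal.ofReal m * (∫⁻ x, g x) ≤ ∫⁻ x, h x := by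
  have meas : ∀ {k : ℝ → ℝ≥0∞}, Measurable fun t : ℝ => volume {x | ENNReal.ofReal t < k x} := by
    intro k
    refine Antitone.measurable fun s t hst => measure_mono fun x hx => ?_
    exact lt_of_le_of_lt (ENNReal.ofReal_le_ofReal hst) hx
  rw [lintegral_eq_lintegral_volume_lt hf, lintegral_eq_lintegral_volume_lt hg,
    lintegral_eq_lintegral_volume_lt hh, ← lintegral_const_mul _ meas, ← lintegral_const_mul _ meas,
    ← lintegral_add_left (meas.const_mul _)]
  refine setLIntegral_mono meas fun t (ht : 0 < t) => ?_
  rcases lt_or_ge t 1 with ht1 | ht1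
  · have ht1' : ENNReal.ofReal t < 1 := by simpa using ht1
    refine ofReal_mul_volume_add_le hl.le hm.le (measurableSet_lt (by fun_prop) hf)
      (measurableSet_lt (by fun_prop) hg) ?_ ?_ ?_
    · rw [← hf1] at ht1'
      exact lt_iSup_iff.1 ht1'
    · rw [← hg1] at ht1'
      exact lt_iSup_iff.1 ht1'
    · intro x hx y hy
      refine lt_of_lt_of_le ?_ (H x y)
      have ht0 : ENNReal.ofReal t ≠ 0 := by simpa using ht
      calc ENNReal.ofReal t = ENNReal.ofReal t ^ l * ENNReal.ofReal t ^ m := by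
            rw [← ENNReal.rpow_add _ _ ht0 ENNReal.ofReal_ne_top, hlm, ENNReal.rpow_one]
        _ < f x ^ l * g y ^ m :=
            ENNReal.mul_lt_mul (ENNReal.rpow_lt_rpow hx hl) (ENNReal.rpow_lt_rpow hy hm)
  · have ht1' : 1 ≤ ENNReal.ofReal t := by simpa using ht1
    have h0 : ∀ k : ℝ → ℝ≥0∞, ⨆ x, k x = 1 → {x | ENNReal.ofReal t < k x} = ∅ := by
      intro k hk
      refine Set.eq_empty_of_forall_notMem fun x hx => ?_
      exact absurd (lt_of_le_of_lt ht1' hx) (not_lt.2 (hk ▸ le_iSup k x))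
    simp [h0 f hf1, h0 g hg1]

-- Scaling both suprema to `1` reduces to the additive inequality, which AM-GM turns into the
-- multiplicative one.
open scoped ENNReal in
lemma prekopa_leindler_of_iSup_ne_top {l m : ℝ} (hl : 0 < l) (hm : 0 < m) (hlm : l + m = 1)
    {f g h : ℝ → ℝ≥0∞} (hf : Measurable f) (hg : Measurable g) (hh : Measurable h)
    (hf1 : ⨆ x, f x ≠ ⊤) (hg1 : ⨆ x, g x ≠ ⊤)
    (H : ∀ x y, f x ^ l * g y ^ m ≤ h (l * x + m * y)) :
    (∫⁻ x, f x) ^ l * (∫⁻ x, g x) ^ m ≤ ∫⁻ x, h x := by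
  rcases eq_or_ne (⨆ x, f x) 0 with hf0 | hf0
  · have : ∀ x, f x = 0 := by simpa using hf0
    simp [this, hl]
  rcases eq_or_ne (⨆ x, g x) 0 with hg0 | hg0
  · have : ∀ x, g x = 0 := by simpa using hg0
    simp [this, hm]
  set M := ⨆ x, f x
  set N := ⨆ x, g x
  set c := M⁻¹ ^ l * N⁻¹ ^ m with hc
  have hM : M⁻¹ ≠ ⊤ := by simpa using hf0
  have hN : N⁻¹ ≠ ⊤ := by simpa using hg0
  have hM0 : M⁻¹ ≠ 0 := by simpa using hf1
  have hN0 : N⁻¹ ≠ 0 := by simpa using hg1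
  have hct : c ≠ ⊤ := ENNReal.mul_ne_top (ENNReal.rpow_ne_top_of_nonneg hl.le hM)
    (ENNReal.rpow_ne_top_of_nonneg hm.le hN)
  have hc0 : c ≠ 0 := mul_ne_zero (ENNReal.rpow_pos hM0.bot_lt hM).ne'
    (ENNReal.rpow_pos hN0.bot_lt hN).ne'
  have mulr : ∀ a b : ℝ≥0∞, (a * M⁻¹) ^ l * (b * N⁻¹) ^ m = a ^ l * b ^ m * c := by
    intro a b
    rw [ENNReal.mul_rpow_of_nonneg _ _ hl.le, ENNReal.mul_rpow_of_nonneg _ _ hm.le, hc]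
    ring
  have key := lintegral_add_le_of_iSup_eq_one hl hm hlm (f := fun x => f x * M⁻¹)
    (g := fun x => g x * N⁻¹) (h := fun x => h x * c) (hf.mul_const _) (hg.mul_const _)
    (hh.mul_const _) (by rw [← ENNReal.iSup_mul]; exact ENNReal.mul_inv_cancel hf0 hf1)
    (by rw [← ENNReal.iSup_mul]; exact ENNReal.mul_inv_cancel hg0 hg1)
    (by
      intro x y
      rw [mulr]
      exact mul_le_mul_left (H x y) c)
  rw [lintegral_mul_const _ hf, lintegral_mul_const _ hg, lintegral_mul_const _ hh] at key
  have k2 := (ENNReal.geom_mean_le_arith_mean2_weighted hl hm hlm _ _).trans key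
  rw [mulr] at k2
  exact (ENNReal.mul_le_mul_iff_left hc0 hct).1 k2

open scoped ENNReal in
lemma iSup_lintegral_min_natCast {f : ℝ → ℝ≥0∞} (hf : Measurable f) :
    ⨆ k : ℕ, ∫⁻ x, min (f x) k = ∫⁻ x, f x := by
  rw [← lintegral_iSup (fun k => hf.min measurable_const)]
  · refine lintegral_congr fun x => ?_
    exact (inf_iSup_eq (f x) (fun k : ℕ => (k : ℝ≥0∞))).symm.trans (by simp [ENNReal.iSup_natCast])
  · intro i j hij x
    exact min_le_min le_rfl (by exact_mod_cast hij)

open scoped ENNReal in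
/-- The one-dimensional Prékopa-Leindler inequality. -/
theorem prekopa_leindler {l m : ℝ} (hl : 0 < l) (hm : 0 < m) (hlm : l + m = 1)
    {f g h : ℝ → ℝ≥0∞} (hf : Measurable f) (hg : Measurable g) (hh : Measurable h)
    (H : ∀ x y, f x ^ l * g y ^ m ≤ h (l * x + m * y)) :
    (∫⁻ x, f x) ^ l * (∫⁻ x, g x) ^ m ≤ ∫⁻ x, h x := by
  have hrpow : ∀ {r : ℝ} (hr : 0 < r) (u : ℕ → ℝ≥0∞), (⨆ k, u k) ^ r = ⨆ k, u k ^ r :=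
    fun hr u => (ENNReal.orderIsoRpow _ hr).map_iSup u
  have htop : ∀ (u : ℝ → ℝ≥0∞) (k : ℕ), ⨆ x, min (u x) k ≠ ⊤ := fun u k =>
    ne_top_of_le_ne_top (ENNReal.natCast_ne_top k) (iSup_le fun x => min_le_right _ _)
  rw [← iSup_lintegral_min_natCast hf, ← iSup_lintegral_min_natCast hg, hrpow hl, hrpow hm,
    ENNReal.iSup_mul]
  refine iSup_le fun i => ?_
  rw [ENNReal.mul_iSup]
  refine iSup_le fun j => ?_
  refine prekopa_leindler_of_iSup_ne_top hl hm hlm (hf.min measurable_const)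
    (hg.min measurable_const) hh (htop f i) (htop g j) fun x y => le_trans ?_ (H x y)
  gcongr
  · exact min_le_left _ _
  · exact min_le_left _ _

open scoped ENNReal in
/-- The two-dimensional Prékopa-Leindler inequality. -/
theorem prekopa_leindler_prod {l m : ℝ} (hl : 0 < l) (hm : 0 < m) (hlm : l + m = 1)
    {f g h : ℝ × ℝ → ℝ≥0∞} (hf : Measurable f) (hg : Measurable g) (hh : Measurable h)
    (H : ∀ z w, f z ^ l * g w ^ m ≤ h (l * z.1 + m * w.1, l * z.2 + m * w.2)) :
    (∫⁻ z, f z) ^ l * (∫⁻ z, g z) ^ m ≤ ∫⁻ z, h z := by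
  rw [Measure.volume_eq_prod, lintegral_prod _ hf.aemeasurable, lintegral_prod _ hg.aemeasurable,
    lintegral_prod _ hh.aemeasurable]
  refine prekopa_leindler hl hm hlm hf.lintegral_prod_right' hg.lintegral_prod_right'
    hh.lintegral_prod_right' fun x y => ?_
  -- The inequality on fibres supplies the hypothesis for the marginals.
  exact prekopa_leindler hl hm hlm (hf.comp measurable_prodMk_left)
    (hg.comp measurable_prodMk_left) (hh.comp measurable_prodMk_left) fun s t => H (x, s) (y, t)

/-! ### Weak supmajorization through elementary transfers -/

/-- Weak supmajorization is generated by increasing one coordinate and by transferring mass from a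
larger coordinate to a smaller one. Only the transfers from a later to an earlier coordinate are
used. -/
lemma le_of_partial_sums_le {n : ℕ} {β : Type*} [Preorder β] (Φ : (Fin n → ℝ) → β)
    (hanti : ∀ v w : Fin n → ℝ, (∀ i, 0 ≤ v i) → (∀ i, v i ≤ w i) → Φ w ≤ Φ v)
    (htransfer : ∀ (v : Fin n → ℝ) (i j : Fin n) (ε : ℝ), (∀ k, 0 ≤ v k) → i < j → v i ≤ v j →
      0 ≤ ε → ε ≤ v j - v i →
      Φ (Function.update (Function.update v i (v i + ε)) j (v j - ε)) ≤ Φ v)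
    {u : Fin n → ℝ} (hu : Monotone u) (hu0 : ∀ i, 0 ≤ u i) :
    ∀ v : Fin n → ℝ, (∀ i, 0 ≤ v i) →
      (∀ j, ∑ i ∈ Finset.Iic j, v i ≤ ∑ i ∈ Finset.Iic j, u i) → Φ u ≤ Φ v := by
  intro v
  -- Induction on the number of coordinates where `u` and `v` differ. Only `u` is assumed monotone;
  -- the intermediate vectors need not be.
  induction hN : (Finset.univ.filter fun k => u k ≠ v k).card using Nat.strong_induction_on
    generalizing v with
  | _ N ih =>
  intro hv0 hsum
  by_cases hle : ∀ i, v i ≤ u i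
  · exact hanti v u hv0 hle
  obtain ⟨j, hj, hjmin⟩ : ∃ j, u j < v j ∧ ∀ k < j, v k ≤ u k := by
    push Not at hle
    obtain ⟨j, hj, hjm⟩ := WellFounded.has_min (wellFounded_lt (α := Fin n)) {j | u j < v j} hle
    exact ⟨j, hj, fun k hk => not_lt.1 fun h => hjm k h hk⟩
  obtain ⟨i, hij, hi⟩ : ∃ i < j, v i < u i := by
    by_contra! hcon
    refine absurd (hsum j) (not_le.2 ?_)
    refine Finset.sum_lt_sum (fun k hk => ?_) ⟨j, by simp, hj⟩
    rcases (Finset.mem_Iic.1 hk).eq_or_lt with rfl | hk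
    · exact hj.le
    · exact hcon k hk
  -- The largest transfer that overshoots neither target: one of the two coordinates becomes
  -- correct, so the count drops. The bounds on `ε` in `htransfer` follow from `v i < u i ≤ u j < v
  -- j`.
  set ε := min (u i - v i) (v j - u j) with hε
  have hε0 : 0 < ε := lt_min (by linarith) (by linarith)
  have hε1 : ε ≤ u i - v i := min_le_left _ _
  have hε2 : ε ≤ v j - u j := min_le_right _ _
  have huij := hu hij.le
  have hijne : i ≠ j := hij.ne
  set v' := Function.update (Function.update v i (v i + ε)) j (v j - ε) with hv'
  have v'j : v' j = v j - ε := by simp [hv']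
  have v'i : v' i = v i + ε := by simp [hv', hijne]
  have v'k : ∀ k, k ≠ i → k ≠ j → v' k = v k := fun k h1 h2 => by simp [hv', h1, h2]
  have hv'0 : ∀ k, 0 ≤ v' k := by
    intro k
    by_cases h1 : k = i
    · subst h1; rw [v'i]; linarith [hv0 k]
    by_cases h2 : k = j
    · subst h2; rw [v'j]; linarith [hu0 k]
    · rw [v'k k h1 h2]; exact hv0 k
  refine le_trans (ih _ ?_ v' rfl hv'0 ?_)
    (htransfer v i j ε hv0 hij (by linarith) hε0.le (by linarith))
  · rw [← hN]
    refine Finset.card_lt_card (Finset.ssubset_iff_of_subset ?_ |>.2 ?_)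
    · intro k hk
      simp only [Finset.mem_filter, Finset.mem_univ, true_and] at hk ⊢
      by_cases h1 : k = i
      · subst h1; exact hi.ne'
      by_cases h2 : k = j
      · subst h2; exact hj.ne
      · rwa [v'k k h1 h2] at hk
    · rcases min_choice (u i - v i) (v j - u j) with h | h
      · refine ⟨i, by simpa using hi.ne', ?_⟩
        simp only [Finset.mem_filter, Finset.mem_univ, true_and, not_not, v'i]
        rw [hε, h]; ring
      · refine ⟨j, by simpa using hj.ne, ?_⟩
        simp only [Finset.mem_filter, Finset.mem_univ, true_and, not_not, v'j]
        rw [hε, h]; ring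
  · intro k
    have hdiff : ∀ l, v' l = v l + ((if l = i then ε else 0) - if l = j then ε else 0) := by
      intro l
      by_cases h1 : l = i
      · subst h1; simp [v'i, hijne]
      by_cases h2 : l = j
      · subst h2; simp [v'j, h1, sub_eq_add_neg]
      · simp [v'k l h1 h2, h1, h2]
    simp_rw [hdiff]
    rw [Finset.sum_add_distrib, Finset.sum_sub_distrib, Finset.sum_ite_eq', Finset.sum_ite_eq']
    simp only [Finset.mem_Iic]
    by_cases hjk : j ≤ k
    · simpa [hjk, hij.le.trans hjk] using hsum k
    -- Only sums ending in `[i, j)` change. There `v ≤ u` termwise by minimality of `j`, and the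
    -- slack at `i` alone is at least `ε`.
    by_cases hik : i ≤ k
    · have h1 : ∑ l ∈ Finset.Iic k, (if l = i then ε else 0) ≤
          ∑ l ∈ Finset.Iic k, (u l - v l) := by
        refine Finset.sum_le_sum fun l hl => ?_
        split_ifs with h
        · rw [h]; exact hε1
        · have := hjmin l (lt_of_le_of_lt (Finset.mem_Iic.1 hl) (not_le.1 hjk))
          linarith
      rw [Finset.sum_ite_eq', Finset.sum_sub_distrib] at h1
      simp only [Finset.mem_Iic, hik, if_true] at h1
      simp only [hik, hjk, if_true, if_false]
      linarith
    · simpa [hjk, hik] using hsum k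

lemma increasingArrangement_monotone {n : ℕ} (x : Fin n → ℝ) :
    Monotone (increasingArrangement x) := Tuple.monotone_sort x

lemma increasingArrangement_comp {n : ℕ} (x : Fin n → ℝ) {φ : ℝ → ℝ} {s : Set ℝ}
    (hφ : MonotoneOn φ s) (hx : ∀ i, x i ∈ s) :
    increasingArrangement (fun i => φ (x i)) = fun i => φ (increasingArrangement x i) := by
  have : Monotone ((fun i => φ (x i)) ∘ Tuple.sort x) := fun i j hij =>
    hφ (hx _) (hx _) (Tuple.monotone_sort x hij)
  exact (Tuple.comp_sort_eq_comp_iff_monotone.2 this).symm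

/-! ### Likelihood ratio order and exchange of weights -/

section LikelihoodRatio

variable {Ω : Type*} [MeasurableSpace Ω] {μ : Measure Ω}

lemma IsDensityOf.ae_eq {X : Ω → ℝ} {f g : ℝ → ℝ} (hf : IsDensityOf μ X f)
    (hg : IsDensityOf μ X g) : f =ᵐ[volume] g := by
  have h := hf.2.2.symm.trans hg.2.2
  rw [withDensity_eq_iff_of_sigmaFinite hf.1.ennreal_ofReal.aemeasurable
    hg.1.ennreal_ofReal.aemeasurable] at h
  filter_upwards [h] with x hx
  exact (ENNReal.ofReal_eq_ofReal_iff (hf.2.1 x) (hg.2.1 x)).1 hx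

/-- The likelihood ratio order in cross-multiplied form, for arbitrary versions of the densities. -/
def EssLikelihoodRatioLE (μ : Measure Ω) (X Y : Ω → ℝ) : Prop :=
  ∃ f g : ℝ → ℝ, IsDensityOf μ X f ∧ IsDensityOf μ Y g ∧
    ∃ S : Set ℝ, (∀ᵐ x, x ∈ S) ∧ ∀ x ∈ S, ∀ y ∈ S, x < y → f y * g x ≤ f x * g y

lemma LikelihoodRatioLE.ess {X Y : Ω → ℝ} (h : LikelihoodRatioLE μ X Y) :
    EssLikelihoodRatioLE μ X Y := by
  obtain ⟨f, g, hf, hg, hmono⟩ := h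
  refine ⟨f, g, hf, hg, Set.univ, by simp, fun x _ y _ hxy => ?_⟩
  by_cases hx : f x ≠ 0 ∨ g x ≠ 0
  swap
  · push Not at hx; simp [hx.1, hx.2]
  by_cases hy : f y ≠ 0 ∨ g y ≠ 0
  swap
  · push Not at hy; simp [hy.1, hy.2]
  have h := hmono hx hy hxy.le
  simp only at h
  have hfx := hf.2.1 x
  have hfy := hf.2.1 y
  have hgx := hg.2.1 x
  have hgy := hg.2.1 y
  rcases hfy.eq_or_lt with h0 | hfy0
  · rw [← h0, zero_mul]; positivity
  rcases hfx.eq_or_lt with h0 | hfx0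
  · have hgx0 : 0 < g x := lt_of_le_of_ne hgx (by simpa [← h0, eq_comm] using hx)
    rw [← h0, ENNReal.ofReal_zero, ENNReal.div_zero (by simpa using hgx0), top_le_iff] at h
    exact absurd h (ENNReal.div_ne_top ENNReal.ofReal_ne_top (by simpa using hfy0))
  rw [← ENNReal.ofReal_div_of_pos hfx0, ← ENNReal.ofReal_div_of_pos hfy0,
    ENNReal.ofReal_le_ofReal_iff (by positivity), div_le_div_iff₀ hfx0 hfy0] at h
  linarith

/-- Multiply the two inequalities and cancel the middle density. The two versions of that density
agree only almost everywhere, hence the set of full measure. -/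
lemma EssLikelihoodRatioLE.trans [IsProbabilityMeasure μ] {X Y Z : Ω → ℝ} (hY : Measurable Y)
    (h₁ : EssLikelihoodRatioLE μ X Y) (h₂ : EssLikelihoodRatioLE μ Y Z) :
    EssLikelihoodRatioLE μ X Z := by
  obtain ⟨f, g, hf, hg, S, hS, hfg⟩ := h₁
  obtain ⟨g', h, hg', hh, T, hT, hgh⟩ := h₂
  have hgg := hg.ae_eq hg'
  refine ⟨f, h, hf, hh, {x | x ∈ S ∧ x ∈ T ∧ g x = g' x}, ?_, ?_⟩
  · filter_upwards [hS, hT, hgg] with x h1 h2 h3 using ⟨h1, h2, h3⟩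
  -- A point where the middle density is positive settles the case where it vanishes at both `x` and
  -- `y` and cannot be cancelled.
  obtain ⟨z, hzS, hzT, hzg, hz⟩ : ∃ z, z ∈ S ∧ z ∈ T ∧ g z = g' z ∧ g z ≠ 0 := by
    by_contra! hcon
    have h0 : (fun x => ENNReal.ofReal (g x)) =ᵐ[volume] 0 := by
      filter_upwards [hS, hT, hgg] with x h1 h2 h3
      simp [hcon x h1 h2 h3]
    have h1 := hg.2.2
    rw [withDensity_congr_ae h0, withDensity_zero] at h1
    have := Measure.isProbabilityMeasure_map (μ := μ) hY.aemeasurable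
    exact IsProbabilityMeasure.ne_zero _ h1
  rintro x ⟨hxS, hxT, hxg⟩ y ⟨hyS, hyT, hyg⟩ hxy
  have hfx := hf.2.1 x
  have hfy := hf.2.1 y
  have hgx := hg.2.1 x
  have hgy := hg.2.1 y
  have hhx := hh.2.1 x
  have hhy := hh.2.1 y
  have hz0 : 0 < g z := lt_of_le_of_ne (hg.2.1 z) (Ne.symm hz)
  by_contra! hlt
  have hpos : 0 < f y * h x := lt_of_le_of_lt (by positivity) hlt
  have hfy0 : 0 < f y := pos_of_mul_pos_left hpos hhx
  have hhx0 : 0 < h x := pos_of_mul_pos_right hpos hfy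
  have e1 := hfg x hxS y hyS hxy
  have e2 := hgh x hxT y hyT hxy
  rw [← hxg, ← hyg] at e2
  rcases hgx.eq_or_lt with hgx0 | hgx0
  · have hgy0 : g y = 0 := by
      rw [← hgx0, zero_mul] at e2
      exact le_antisymm (nonpos_of_mul_nonpos_left e2 hhx0) hgy
    rcases lt_trichotomy z x with hzx | rfl | hxz
    · have := hfg z hzS y hyS (hzx.trans hxy)
      rw [hgy0, mul_zero] at this
      exact absurd this (not_le.2 (mul_pos hfy0 hz0))
    · exact hz hgx0.symm
    · have := hgh x hxT z hzT hxz
      rw [← hzg, ← hxg, ← hgx0, zero_mul] at this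
      exact absurd this (not_le.2 (mul_pos hz0 hhx0))
  · rcases hgy.eq_or_lt with hgy0 | hgy0
    · rw [← hgy0, mul_zero] at e1
      exact absurd e1 (not_le.2 (mul_pos hfy0 hgx0))
    · refine absurd (mul_le_mul e1 e2 (by positivity) (by positivity)) (not_le.2 ?_)
      have := mul_lt_mul_of_pos_right hlt (mul_pos hgx0 hgy0)
      linarith

lemma essLikelihoodRatioLE_of_lt [IsProbabilityMeasure μ] {n : ℕ} {X : Fin n → Ω → ℝ}
    (hmeas : ∀ i, Measurable (X i))
    (hlr : ∀ i j : Fin n, (i : ℕ) + 1 = (j : ℕ) → LikelihoodRatioLE μ (X j) (X i))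
    {i j : Fin n} (hij : i < j) : EssLikelihoodRatioLE μ (X j) (X i) := by
  obtain ⟨j, hj⟩ := j
  induction j with
  | zero => exact absurd hij (by simp [Fin.lt_def])
  | succ k ih =>
    have hk : k < n := by omega
    have h1 := (hlr ⟨k, hk⟩ ⟨k + 1, hj⟩ rfl).ess
    rcases (Nat.lt_succ_iff.1 (Fin.lt_def.1 hij)).eq_or_lt with h | h
    · have : i = ⟨k, hk⟩ := Fin.ext h
      rw [this]; exact h1
    · exact h1.trans (hmeas _) (ih hk h)

lemma map_prodMk_eq_withDensity [IsProbabilityMeasure μ] {X Y : Ω → ℝ} (hX : Measurable X)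
    (hY : Measurable Y) (hXY : IndepFun X Y μ) {f g : ℝ → ℝ} (hf : IsDensityOf μ X f)
    (hg : IsDensityOf μ Y g) :
    μ.map (fun ω => (X ω, Y ω)) =
      volume.withDensity fun z : ℝ × ℝ => ENNReal.ofReal (f z.1) * ENNReal.ofReal (g z.2) := by
  rw [(indepFun_iff_map_prod_eq_prod_map_map hX.aemeasurable hY.aemeasurable).1 hXY, hf.2.2,
    hg.2.2, prod_withDensity hf.1.ennreal_ofReal hg.1.ennreal_ofReal, Measure.volume_eq_prod]

/-- Giving the larger weight to the larger variable in the likelihood ratio order increases a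
weighted sum stochastically. -/
lemma measure_lt_swap_le [IsProbabilityMeasure μ] {X Y : Ω → ℝ} (hX : Measurable X)
    (hY : Measurable Y) (hXY : IndepFun X Y μ) (h : EssLikelihoodRatioLE μ Y X) {c d : ℝ}
    (hcd : c ≤ d) (s : ℝ) :
    μ {ω | s < c * X ω + d * Y ω} ≤ μ {ω | s < d * X ω + c * Y ω} := by
  obtain ⟨g, f, hg, hf, S, hS, hfg⟩ := h
  have hlaw := map_prodMk_eq_withDensity hX hY hXY hf hg
  set A := {z : ℝ × ℝ | s < c * z.1 + d * z.2} with hA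
  set B := {z : ℝ × ℝ | s < d * z.1 + c * z.2} with hB
  have hAm : MeasurableSet A := measurableSet_lt (by fun_prop) (by fun_prop)
  have hBm : MeasurableSet B := measurableSet_lt (by fun_prop) (by fun_prop)
  set w : ℝ × ℝ → ENNReal := fun z => ENNReal.ofReal (f z.1) * ENNReal.ofReal (g z.2) with hw
  have hwm : Measurable w := by
    have h1 := hf.1
    have h2 := hg.1
    fun_prop
  have hXYm : Measurable fun ω => (X ω, Y ω) := hX.prodMk hY
  have eA : μ {ω | s < c * X ω + d * Y ω} = volume.withDensity w A := by
    rw [← hlaw, Measure.map_apply hXYm hAm]; rfl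
  have eB : μ {ω | s < d * X ω + c * Y ω} = volume.withDensity w B := by
    rw [← hlaw, Measure.map_apply hXYm hBm]; rfl
  -- After removing `A ∩ B`, reflection in the diagonal maps `A \ B` into `B \ A`. Points of `A \ B`
  -- have `z.1 < z.2`, so the ratio order says that reflection does not decrease the joint density.
  rw [eA, eB, ← measure_inter_add_sdiff A hBm, ← measure_inter_add_sdiff B hAm, Set.inter_comm B A]
  refine add_le_add le_rfl ?_
  rw [withDensity_apply _ (hAm.diff hBm), withDensity_apply _ (hBm.diff hAm),
    ← lintegral_indicator (hAm.diff hBm), ← lintegral_indicator (hBm.diff hAm)]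
  have hswap : MeasurePreserving (Prod.swap : ℝ × ℝ → ℝ × ℝ) volume volume :=
    Measure.measurePreserving_swap
  rw [← hswap.lintegral_comp (hwm.indicator (hBm.diff hAm))]
  refine lintegral_mono_ae ?_
  have h1 : ∀ᵐ z : ℝ × ℝ, z.1 ∈ S := Measure.quasiMeasurePreserving_fst.ae hS
  have h2 : ∀ᵐ z : ℝ × ℝ, z.2 ∈ S := Measure.quasiMeasurePreserving_snd.ae hS
  filter_upwards [h1, h2] with z hz1 hz2
  by_cases hz : z ∈ A \ B
  · have hz' : z.swap ∈ B \ A := by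
      simp only [hA, hB, Set.mem_sdiff, Set.mem_ofPred_eq, Prod.fst_swap, Prod.snd_swap] at hz ⊢
      constructor
      · linarith [hz.1]
      · intro h; exact hz.2 (by linarith)
    rw [Set.indicator_of_mem hz, Set.indicator_of_mem hz']
    have hlt : z.1 < z.2 := by
      simp only [hA, hB, Set.mem_sdiff, Set.mem_ofPred_eq] at hz
      by_contra! hle
      exact hz.2 (by nlinarith [hz.1, mul_nonneg (sub_nonneg.2 hcd) (sub_nonneg.2 hle)])
    simp only [hw, Prod.fst_swap, Prod.snd_swap]
    rw [← ENNReal.ofReal_mul (hf.2.1 _), ← ENNReal.ofReal_mul (hf.2.1 _)]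
    refine ENNReal.ofReal_le_ofReal ?_
    linarith [hfg z.1 hz1 z.2 hz2 hlt]
  · rw [Set.indicator_of_notMem hz]; exact zero_le

end LikelihoodRatio

/-! ### Log-concavity of tails and the two-variable transfer -/

section LogConcavity

/-- Hölder for two-term sums, after splitting each coefficient as `l = l ^ p⁻¹ * l ^ q⁻¹`. -/
lemma rpow_mul_rpow_concave {p q : ℝ} (hpq : p.HolderConjugate q) {l m a b x y : ℝ}
    (hl : 0 ≤ l) (hm : 0 ≤ m) (ha : 0 ≤ a) (hb : 0 ≤ b) (hx : 0 ≤ x) (hy : 0 ≤ y) :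
    l * (a ^ q⁻¹ * x ^ p⁻¹) + m * (b ^ q⁻¹ * y ^ p⁻¹) ≤
      (l * a + m * b) ^ q⁻¹ * (l * x + m * y) ^ p⁻¹ := by
  have h := Real.inner_le_Lp_mul_Lq_of_nonneg (Finset.univ : Finset (Fin 2))
    (f := ![(l * x) ^ p⁻¹, (m * y) ^ p⁻¹]) (g := ![(l * a) ^ q⁻¹, (m * b) ^ q⁻¹]) hpq
    (by intro i _; fin_cases i <;> simp <;> positivity)
    (by intro i _; fin_cases i <;> simp <;> positivity)
  have hsplit : ∀ {t : ℝ}, 0 ≤ t → t ^ p⁻¹ * t ^ q⁻¹ = t := by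
    intro t ht
    rw [← Real.rpow_add_of_nonneg ht (inv_nonneg.2 hpq.nonneg) (inv_nonneg.2 hpq.symm.nonneg),
      hpq.inv_add_inv_eq_one, Real.rpow_one]
  simp only [Fin.sum_univ_two, Matrix.cons_val_zero, Matrix.cons_val_one, one_div] at h
  rw [Real.rpow_inv_rpow (by positivity) hpq.ne_zero, Real.rpow_inv_rpow (by positivity) hpq.ne_zero,
    Real.rpow_inv_rpow (by positivity) hpq.symm.ne_zero,
    Real.rpow_inv_rpow (by positivity) hpq.symm.ne_zero,
    Real.mul_rpow hl hx, Real.mul_rpow hl ha, Real.mul_rpow hm hy, Real.mul_rpow hm hb] at h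
  calc _ = l ^ p⁻¹ * x ^ p⁻¹ * (l ^ q⁻¹ * a ^ q⁻¹) + m ^ p⁻¹ * y ^ p⁻¹ * (m ^ q⁻¹ * b ^ q⁻¹) := by
        nth_rewrite 1 [← hsplit hl, ← hsplit hm]; ring
    _ ≤ _ := h
    _ = _ := mul_comm _ _

lemma IsLogConcaveOn.ofReal_rpow_mul_le {f : ℝ → ℝ} (hf : IsLogConcaveOn Set.univ f) {l m : ℝ}
    (hl : 0 ≤ l) (hm : 0 ≤ m) (hlm : l + m = 1) (x y : ℝ) :
    ENNReal.ofReal (f x) ^ l * ENNReal.ofReal (f y) ^ m ≤ ENNReal.ofReal (f (l * x + m * y)) := by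
  have h0 := fun x => hf.2.1 x (Set.mem_univ x)
  obtain rfl : m = 1 - l := by linarith
  have h := hf.2.2 x trivial y trivial l hl (by linarith)
  rw [ENNReal.ofReal_rpow_of_nonneg (h0 x) hl, ENNReal.ofReal_rpow_of_nonneg (h0 y) hm,
    ← ENNReal.ofReal_mul (Real.rpow_nonneg (h0 x) _)]
  exact ENNReal.ofReal_le_ofReal h

variable {Ω : Type*} [MeasurableSpace Ω] {μ : Measure Ω} [IsProbabilityMeasure μ]

/-- The tail of a weighted sum is log-concave in the `q`-th powers of the weights. -/
lemma measure_lt_log_concave {p q : ℝ} (hpq : p.HolderConjugate q) {X Y : Ω → ℝ}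
    (hX : Measurable X) (hY : Measurable Y) (hXY : IndepFun X Y μ)
    (hX0 : ∀ᵐ ω ∂μ, 0 ≤ X ω) (hY0 : ∀ᵐ ω ∂μ, 0 ≤ Y ω)
    (hXl : HasLogConcaveDensity μ fun ω => X ω ^ p) (hYl : HasLogConcaveDensity μ fun ω => Y ω ^ p)
    {l m : ℝ} (hl : 0 < l) (hm : 0 < m) (hlm : l + m = 1) {a b c d : ℝ}
    (ha : 0 ≤ a) (hb : 0 ≤ b) (hc : 0 ≤ c) (hd : 0 ≤ d) (s : ℝ) :
    μ {ω | s < a ^ q⁻¹ * X ω + b ^ q⁻¹ * Y ω} ^ l * μ {ω | s < c ^ q⁻¹ * X ω + d ^ q⁻¹ * Y ω} ^ m ≤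
      μ {ω | s < (l * a + m * c) ^ q⁻¹ * X ω + (l * b + m * d) ^ q⁻¹ * Y ω} := by
  obtain ⟨f, hf, hfl⟩ := hXl
  obtain ⟨g, hg, hgl⟩ := hYl
  have hXp : Measurable fun ω => X ω ^ p := hX.pow_const p
  have hYp : Measurable fun ω => Y ω ^ p := hY.pow_const p
  have hlaw := map_prodMk_eq_withDensity hXp hYp
    (hXY.comp (φ := fun x => x ^ p) (ψ := fun x => x ^ p) (by fun_prop) (by fun_prop)) hf hg
  -- Concavity needs the closed quadrant, which carries the law of the `p`-th powers.
  let D : ℝ → ℝ → Set (ℝ × ℝ) := fun a b =>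
    {z | (0 ≤ z.1 ∧ 0 ≤ z.2) ∧ s < a ^ q⁻¹ * z.1 ^ p⁻¹ + b ^ q⁻¹ * z.2 ^ p⁻¹}
  have hD : ∀ a b, MeasurableSet (D a b) := by
    intro a b
    have h1 : MeasurableSet {z : ℝ × ℝ | 0 ≤ z.1} := measurableSet_le (by fun_prop) (by fun_prop)
    have h2 : MeasurableSet {z : ℝ × ℝ | 0 ≤ z.2} := measurableSet_le (by fun_prop) (by fun_prop)
    have h3 : MeasurableSet {z : ℝ × ℝ | s < a ^ q⁻¹ * z.1 ^ p⁻¹ + b ^ q⁻¹ * z.2 ^ p⁻¹} :=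
      measurableSet_lt (by fun_prop) (by fun_prop)
    exact (h1.inter h2).inter h3
  let w : ℝ × ℝ → ENNReal := fun z => ENNReal.ofReal (f z.1) * ENNReal.ofReal (g z.2)
  have hwm : Measurable w := by
    have h1 := hf.1
    have h2 := hg.1
    fun_prop
  have hrep : ∀ a b, μ {ω | s < a ^ q⁻¹ * X ω + b ^ q⁻¹ * Y ω} = ∫⁻ z, (D a b).indicator w z := by
    intro a b
    rw [lintegral_indicator (hD a b), ← withDensity_apply _ (hD a b), ← hlaw,
      Measure.map_apply (hXp.prodMk hYp) (hD a b)]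
    refine measure_congr ?_
    filter_upwards [hX0, hY0] with ω h1 h2
    have e1 : (X ω ^ p) ^ p⁻¹ = X ω := Real.rpow_rpow_inv h1 hpq.ne_zero
    have e2 : (Y ω ^ p) ^ p⁻¹ = Y ω := Real.rpow_rpow_inv h2 hpq.ne_zero
    have e3 := Real.rpow_nonneg h1 p
    have e4 := Real.rpow_nonneg h2 p
    refine propext ?_
    change s < a ^ q⁻¹ * X ω + b ^ q⁻¹ * Y ω ↔ (0 ≤ X ω ^ p ∧ 0 ≤ Y ω ^ p) ∧
      s < a ^ q⁻¹ * (X ω ^ p) ^ p⁻¹ + b ^ q⁻¹ * (Y ω ^ p) ^ p⁻¹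
    rw [e1, e2]
    tauto
  rw [hrep, hrep, hrep]
  refine prekopa_leindler_prod hl hm hlm (hwm.indicator (hD _ _)) (hwm.indicator (hD _ _))
    (hwm.indicator (hD _ _)) fun z z' => ?_
  by_cases hz : z ∈ D a b
  swap
  · simp [hz, hl]
  by_cases hz' : z' ∈ D c d
  swap
  · simp [hz', hm]
  have hmem : (l * z.1 + m * z'.1, l * z.2 + m * z'.2) ∈ D (l * a + m * c) (l * b + m * d) := by
    obtain ⟨⟨h1, h2⟩, h3⟩ := hz
    obtain ⟨⟨h4, h5⟩, h6⟩ := hz'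
    refine ⟨⟨by positivity, by positivity⟩, ?_⟩
    have e1 := rpow_mul_rpow_concave hpq hl.le hm.le ha hc h1 h4
    have e2 := rpow_mul_rpow_concave hpq hl.le hm.le hb hd h2 h5
    have e3 := mul_lt_mul_of_pos_left h3 hl
    have e4 := mul_lt_mul_of_pos_left h6 hm
    have e5 : l * s + m * s = s := by rw [← add_mul, hlm, one_mul]
    simp only
    linarith
  rw [Set.indicator_of_mem hz, Set.indicator_of_mem hz', Set.indicator_of_mem hmem]
  simp only [w]
  rw [ENNReal.mul_rpow_of_nonneg _ _ hl.le, ENNReal.mul_rpow_of_nonneg _ _ hm.le]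
  calc _ = (ENNReal.ofReal (f z.1) ^ l * ENNReal.ofReal (f z'.1) ^ m) *
        (ENNReal.ofReal (g z.2) ^ l * ENNReal.ofReal (g z'.2) ^ m) := by ring
    _ ≤ _ := mul_le_mul' (hfl.ofReal_rpow_mul_le hl.le hm.le hlm _ _)
        (hgl.ofReal_rpow_mul_le hl.le hm.le hlm _ _)

/-- Two-variable case: moving `ε` from the `q`-th power of the larger weight, on the smaller
variable, to that of the other weight increases the weighted sum stochastically. -/
lemma stochasticLE_transfer {p q : ℝ} (hpq : p.HolderConjugate q) {X Y : Ω → ℝ}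
    (hX : Measurable X) (hY : Measurable Y) (hXY : IndepFun X Y μ)
    (hX0 : ∀ᵐ ω ∂μ, 0 ≤ X ω) (hY0 : ∀ᵐ ω ∂μ, 0 ≤ Y ω)
    (hXl : HasLogConcaveDensity μ fun ω => X ω ^ p) (hYl : HasLogConcaveDensity μ fun ω => Y ω ^ p)
    (h : EssLikelihoodRatioLE μ Y X) {a b ε : ℝ} (ha : 0 ≤ a) (hab : a ≤ b) (hε : 0 ≤ ε)
    (hε' : ε ≤ b - a) :
    StochasticLE μ (fun ω => a ^ q⁻¹ * X ω + b ^ q⁻¹ * Y ω)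
      (fun ω => (a + ε) ^ q⁻¹ * X ω + (b - ε) ^ q⁻¹ * Y ω) := by
  have hb : 0 ≤ b := ha.trans hab
  have hcd : a ^ q⁻¹ ≤ b ^ q⁻¹ := Real.rpow_le_rpow ha hab (inv_nonneg.2 hpq.symm.nonneg)
  have key : ∀ s, μ {ω | s < a ^ q⁻¹ * X ω + b ^ q⁻¹ * Y ω} ≤
      μ {ω | s < (a + ε) ^ q⁻¹ * X ω + (b - ε) ^ q⁻¹ * Y ω} := by
    intro s
    have hswap := measure_lt_swap_le hX hY hXY h hcd s
    -- The endpoints `ε = 0` and `ε = b - a` are separate, since Prékopa-Leindler here needs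
    -- positive weights.
    rcases hε.eq_or_lt with rfl | hε0
    · simp
    rcases hε'.eq_or_lt with rfl | hε1
    · simpa using hswap
    have hba : 0 < b - a := hε0.trans hε1
    have hl : 0 < 1 - ε / (b - a) := by rw [sub_pos, div_lt_one hba]; exact hε1
    have hm : 0 < ε / (b - a) := by positivity
    -- `(a + ε, b - ε)` divides the segment from `(a, b)` to `(b, a)` with weight `ε / (b - a)` on
    -- the latter.
    have hlc := measure_lt_log_concave hpq hX hY hXY hX0 hY0 hXl hYl hl hm (by ring) ha hb hb ha s
    have e1 : (1 - ε / (b - a)) * a + ε / (b - a) * b = a + ε := by field_simp; ring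
    have e2 : (1 - ε / (b - a)) * b + ε / (b - a) * a = b - ε := by field_simp; ring
    rw [e1, e2] at hlc
    refine le_trans ?_ hlc
    set K := μ {ω | s < a ^ q⁻¹ * X ω + b ^ q⁻¹ * Y ω} with hK
    rcases eq_or_ne K 0 with h0 | h0
    · rw [h0]; exact zero_le
    calc K = K ^ (1 - ε / (b - a)) * K ^ (ε / (b - a)) := by
          rw [← ENNReal.rpow_add _ _ h0 (measure_ne_top _ _), sub_add_cancel, ENNReal.rpow_one]
      _ ≤ _ := by gcongr
  intro s
  have hc : ∀ Z : Ω → ℝ, Measurable Z → μ {ω | Z ω ≤ s} = 1 - μ {ω | s < Z ω} := by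
    intro Z hZ
    rw [← prob_compl_eq_one_sub (measurableSet_lt measurable_const hZ)]
    congr 1
    ext ω
    simp
  rw [hc _ (by fun_prop), hc _ (by fun_prop)]
  exact tsub_le_tsub_left (key s) 1

/-- Adding an independent summand preserves the stochastic order. -/
lemma StochasticLE.add_right {X Y Z : Ω → ℝ} (hX : Measurable X) (hY : Measurable Y)
    (hZ : Measurable Z) (hXZ : IndepFun X Z μ) (hYZ : IndepFun Y Z μ) (h : StochasticLE μ X Y) :
    StochasticLE μ (fun ω => X ω + Z ω) (fun ω => Y ω + Z ω) := by
  intro t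
  have hS : MeasurableSet {z : ℝ × ℝ | z.1 + z.2 ≤ t} :=
    measurableSet_le (by fun_prop) (by fun_prop)
  have hrep : ∀ W : Ω → ℝ, Measurable W → IndepFun W Z μ →
      μ {ω | W ω + Z ω ≤ t} = ∫⁻ z, μ {ω | W ω ≤ t - z} ∂(μ.map Z) := by
    intro W hW hWZ
    have h1 : μ {ω | W ω + Z ω ≤ t} = μ.map (fun ω => (W ω, Z ω)) {z : ℝ × ℝ | z.1 + z.2 ≤ t} := by
      rw [Measure.map_apply (hW.prodMk hZ) hS]; rfl
    have := Measure.isProbabilityMeasure_map (μ := μ) hW.aemeasurable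
    have := Measure.isProbabilityMeasure_map (μ := μ) hZ.aemeasurable
    rw [h1, (indepFun_iff_map_prod_eq_prod_map_map hW.aemeasurable hZ.aemeasurable).1 hWZ,
      Measure.prod_apply_symm hS]
    refine lintegral_congr fun z => ?_
    rw [Measure.map_apply hW (measurable_prodMk_right hS)]
    congr 1
    ext ω
    simp [le_sub_iff_add_le]
  rw [hrep _ hX hXZ, hrep _ hY hYZ]
  exact lintegral_mono fun z => h _

end LogConcavity

/-! ### Assembly for `n` variables -/

theorem corollary4p2 {Ω : Type*} [MeasurableSpace Ω] (μ : Measure Ω) [IsProbabilityMeasure μ]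
    (p q : ℝ) (hp : 1 < p) (hq : 1 < q) (hpq : p⁻¹ + q⁻¹ = 1)
    (n : ℕ) (X : Fin n → Ω → ℝ)
    (hmeas : ∀ i, Measurable (X i))
    (hindep : iIndepFun X μ)
    (hnonneg : ∀ i, ∀ᵐ ω ∂μ, 0 ≤ X i ω)
    (hlr : ∀ i j : Fin n, (i : ℕ) + 1 = (j : ℕ) → LikelihoodRatioLE μ (X j) (X i))
    (hlc : ∀ i, HasLogConcaveDensity μ (fun ω => X i ω ^ p))
    (a b : Fin n → ℝ) (ha : ∀ i, 0 ≤ a i) (hb : ∀ i, 0 ≤ b i)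
    (hab : WeaklySupmajorizedBy (fun i => a i ^ q) (fun i => b i ^ q)) :
    StochasticLE μ (fun ω => ∑ i, increasingArrangement b i * X i ω)
      (fun ω => ∑ i, increasingArrangement a i * X i ω) := by
  have hH : p.HolderConjugate q := Real.holderConjugate_iff.2 ⟨hp, hpq⟩
  have hq0 : 0 < q := by linarith
  intro t
  have hmono : MonotoneOn (fun x : ℝ => x ^ q) (Set.Ici 0) := fun x hx y _ hxy =>
    Real.rpow_le_rpow hx hxy hq0.le
  have harr : ∀ c : Fin n → ℝ, (∀ i, 0 ≤ c i) →
      (increasingArrangement fun i => c i ^ q) = fun i => increasingArrangement c i ^ q :=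
    fun c hc => increasingArrangement_comp c hmono hc
  have harr0 : ∀ c : Fin n → ℝ, (∀ i, 0 ≤ c i) → ∀ i, 0 ≤ increasingArrangement c i :=
    fun c hc i => hc _
  have hinv : ∀ c : Fin n → ℝ, (∀ i, 0 ≤ c i) → ∀ i,
      (increasingArrangement (fun i => c i ^ q) i) ^ q⁻¹ = increasingArrangement c i := by
    intro c hc i
    rw [harr c hc]
    exact Real.rpow_rpow_inv (harr0 c hc i) hq0.ne'
  have main := le_of_partial_sums_le (fun v => μ {ω | ∑ i, v i ^ q⁻¹ * X i ω ≤ t}) ?_ ?_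
    (increasingArrangement_monotone fun i => a i ^ q)
    (harr0 _ fun i => Real.rpow_nonneg (ha i) q) (increasingArrangement fun i => b i ^ q)
    (harr0 _ fun i => Real.rpow_nonneg (hb i) q) hab
  · simpa only [hinv a ha, hinv b hb] using main
  · intro v w hv hvw
    refine measure_mono_ae ?_
    filter_upwards [ae_all_iff.2 hnonneg] with ω hω hw
    refine le_trans (Finset.sum_le_sum fun i _ => ?_) hw
    exact mul_le_mul_of_nonneg_right
      (Real.rpow_le_rpow (hv i) (hvw i) (inv_nonneg.2 hq0.le)) (hω i)
  · intro v i j ε hv hij hvij hε hε'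
    have hne : i ≠ j := hij.ne
    set v' := Function.update (Function.update v i (v i + ε)) j (v j - ε) with hv'
    -- The summands untouched by the transfer, independent of the pair `(X i, X j)`.
    set Z : Ω → ℝ := fun ω => ∑ k ∈ (Finset.univ.erase i).erase j, v k ^ q⁻¹ * X k ω with hZ
    have hsplit : ∀ (u : Fin n → ℝ), (∀ k, k ≠ i → k ≠ j → u k = v k) → ∀ ω,
        ∑ k, u k ^ q⁻¹ * X k ω = u i ^ q⁻¹ * X i ω + u j ^ q⁻¹ * X j ω + Z ω := by
      intro u hu ω
      rw [← Finset.add_sum_erase _ _ (Finset.mem_univ i), ← Finset.add_sum_erase _ _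
        (Finset.mem_erase.2 ⟨hne.symm, Finset.mem_univ j⟩), add_assoc, hZ]
      congr 2
      refine Finset.sum_congr rfl fun k hk => ?_
      rw [hu k (by simp at hk; tauto) (by simp at hk; tauto)]
    have hZm : Measurable Z := by fun_prop
    have hpair : IndepFun (fun ω => (X i ω, X j ω)) Z μ := by
      have h0 := hindep.indepFun_finset {i, j} ((Finset.univ.erase i).erase j)
        (by
          rw [Finset.disjoint_left]
          intro k hk hk'
          simp at hk hk'
          tauto) hmeas
      exact h0.comp
        (φ := fun x : ({i, j} : Finset (Fin n)) → ℝ => (x ⟨i, by simp⟩, x ⟨j, by simp⟩))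
        (ψ := fun x : ((Finset.univ.erase i).erase j : Finset (Fin n)) → ℝ =>
          ∑ k ∈ ((Finset.univ.erase i).erase j).attach, v k ^ q⁻¹ * x k)
        (by fun_prop) (by fun_prop) |>.congr (by rfl) (by
          refine Filter.EventuallyEq.of_eq ?_
          ext ω
          exact Finset.sum_attach _ fun k => v k ^ q⁻¹ * X k ω)
    have hlin : ∀ c d : ℝ, IndepFun (fun ω => c * X i ω + d * X j ω) Z μ := fun c d =>
      hpair.comp (φ := fun z : ℝ × ℝ => c * z.1 + d * z.2) (ψ := id) (by fun_prop) measurable_id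
    have htwo := stochasticLE_transfer hH (hmeas i) (hmeas j) (hindep.indepFun hne) (hnonneg i)
      (hnonneg j) (hlc i) (hlc j) (essLikelihoodRatioLE_of_lt hmeas hlr hij) (hv i) hvij hε hε'
    have hi := hmeas i
    have hj := hmeas j
    have hfin := htwo.add_right (Z := Z) (by fun_prop) (by fun_prop) hZm (hlin _ _) (hlin _ _) t
    simp only [hsplit v fun _ _ _ => rfl, hsplit v' fun k h1 h2 => by simp [hv', h1, h2]]
    simpa [hv', hne] using hfin
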